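/- Let $N\ge 1$, let $W_1\subset\mathbb{R}^N$ be compact, and let $\rho$ be a Borel probability measure on $\mathbb{R}^N$ with $\rho(W_1)=1$. For $n\ge 1$ let $\mu=\rho\times\cdots\times\rho$ ($n$ factors) be the law of $n$ i.i.d. spins. Let $J$ be a real symmetric $N\times N$ matrix, let $h\in\mathbb{R}^N$, and for each $n$ let $A_n$ be a real symmetric $n\times n$ matrix. For $x=(x_1,\dots,x_n)\in(\mathbb{R}^N)^n$ put $$H_n^{J,h}(x)=\frac12\sum_{i,j=1}^n A_n(i,j)\,x_i^TJx_j+\sum_{i=1}^n x_i^Th .$$ Suppose that, as $n\to\infty$, $$\operatorname{tr}(A_n^2)=o(n)\qquad\text{and}\qquad \sup_{x\in[0,1]^n}\sum_{i=1}^n\Big|\sum_{j=1}^n A_n(i,j)x_j\Big|=O(n).$$ Then $$\lim_{n\to\infty}\frac1n\left[\log\int_{W_1^n}e^{H_n^{J,h}(x)}\,d\mu(x)-\max_{\nu}\Big\{H_n^{J,h}(m(\nu))-\sum_{i=1}^n D(\nu_i\,\|\,\rho)\Big\}\right]=0,$$ where the maximum is over all product probability measures $\nu=\nu_1\times\cdots\times\nu_n$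 on $(\mathbb{R}^N)^n$ with $\nu\ll\mu$, and is attained and finite for every $n$. Here $m(\nu)=(m(\nu_1),\dots,m(\nu_n))$ with $m(\nu_i)=\int z\,d\nu_i(z)$ the mean of $\nu_i$, and $D(\xi\,\|\,\rho)=\int\log\frac{d\xi}{d\rho}\,d\xi\in[0,\infty]$ is the Kullback--Leibler divergence. -/

import Mathlib

open MeasureTheory ProbabilityTheory Filter Topology Asymptotics
open scoped Matrix ENNReal

/-- The Hamiltonian `½ ∑ i j, A i j * (x iᵀ J x j) + ∑ i, x iᵀ h` of a configuration
`x = (x 1, …, x n)` of `n` spins in `ℝ^N`. -/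
noncomputable def vectorSpinHamiltonian {N n : ℕ} (J : Matrix (Fin N) (Fin N) ℝ)
    (h : Fin N → ℝ) (A : Matrix (Fin n) (Fin n) ℝ) (x : Fin n → Fin N → ℝ) : ℝ :=
  1 / 2 * ∑ i, ∑ j, A i j * (x i ⬝ᵥ (J *ᵥ x j)) + ∑ i, x i ⬝ᵥ h

/-- The partition function `Z = ∫_{W^n} exp (H x) d(ρ × ⋯ × ρ)(x)`. -/
noncomputable def vectorSpinPartition {N n : ℕ} (ρ : Measure (Fin N → ℝ)) (W : Set (Fin N → ℝ))
    (J : Matrix (Fin N) (Fin N) ℝ) (h : Fin N → ℝ) (A : Matrix (Fin n) (Fin n) ℝ) : ℝ :=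
  ∫ x in Set.univ.pi (fun _ : Fin n => W), Real.exp (vectorSpinHamiltonian J h A x)
    ∂(Measure.pi fun _ : Fin n => ρ)

/-- The mean `m(ν) = (m(ν 1), …, m(ν n))` of the product measure with factors `ν i`. -/
noncomputable def meanVector {N n : ℕ} (ν : Fin n → Measure (Fin N → ℝ)) : Fin n → Fin N → ℝ :=
  fun i => ∫ z, z ∂(ν i)

/-- The values `H(m(ν)) - ∑ i, D(ν i ‖ ρ)` of the mean-field functional, where
`ν = ν 1 × ⋯ × ν n` ranges over the product probability measures that are absolutely continuous
with respect to `ρ × ⋯ × ρ`.  A value is `-∞` when some relative entropy is infinite. -/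
def meanFieldValues {N n : ℕ} (ρ : Measure (Fin N → ℝ))
    (J : Matrix (Fin N) (Fin N) ℝ) (h : Fin N → ℝ) (A : Matrix (Fin n) (Fin n) ℝ) : Set EReal :=
  {v | ∃ ν : Fin n → Measure (Fin N → ℝ), (∀ i, IsProbabilityMeasure (ν i)) ∧
    Measure.pi ν ≪ Measure.pi (fun _ : Fin n => ρ) ∧
    v = (vectorSpinHamiltonian J h A (meanVector ν) : EReal) -
      ((∑ i, InformationTheory.klDiv (ν i) ρ : ℝ≥0∞) : EReal)}

/-!
The mean-field approximation for vector spins: `log Z = max_ν {H (m(ν)) - D(ν ‖ μ)} + o(n)`,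
the maximum being over product measures.

*The maximiser.* By Gibbs' variational inequality, `D(ν i ‖ ρ) ≥ θ ⬝ᵥ m(ν i) - logMgf ρ θ` for each
field `θ`, with equality for the exponential tilt of `ρ` by `θ`. Around the mean `a` of a product
measure, `H` has a concave quadratic minorant which is a sum over sites; its mean-field functional
is maximised, site by site, by tilts with bounded fields, which minimise a finite-dimensional convex
dual function. Hence only tilts with fields in a compact set compete, and the maximum is attained.
A maximising tilt may be chosen to solve the mean-field equation `θ = ∇H (m(θ))`. All this holds for
any quadratic function in place of `H` (`exists_meanField_maximizer`,
`exists_quadratic_maximizer`).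

*Lower bound.* Gibbs' variational principle at the maximising product of tilts gives
`log Z ≥ E_ν[H] - D(ν ‖ μ)`, and `E_ν[H]` differs from `H (m(ν))` only by diagonal terms, of order
`∑ i, |A i i| ≤ (n tr A²)^(1/2) = o(n)` (`le_log_integral_exp`).

*Upper bound.* If the exponent `H` were concave, it would be dominated by its linearisation at a
solution of the mean-field equation, and `log Z` would be at most the maximum. In general, let `b p`
be the eigenvalues of `A ⊗ J` and `(V x) p` the coordinates of `x` in an eigenbasis. For `t > 0` the
Hubbard–Stratonovich identity writes the exponential of `∑ p, b p² / (2 t) (V x) p² / 2` as a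
Gaussian average of exponentials of linear functions. This replaces each `b p` by
`b p - b p² / (2 t) ≤ t / 2`, so that, for each value `g` of the Gaussian field, the exponent is
concave up to an error `O(t n)` (`lintegral_exp_field_le`). Relative to `H`, the maximum of the new
functional gains at most the supremum over `m` of `g ⬝ᵥ T m - |T m|² / 2`, where
`T = diag (b p / (2 t)^(1/2)) V` and `|m|² = O(n)`; a multiplier `s` for this constraint bounds the
gain by `O(s n)` plus a quadratic form in `g` whose Gaussian exponential moment is at most
`exp (tr (T Tᵀ) / (2 s)) = exp (tr A² tr J² / (4 s t))` (`lintegral_exp_sum_sq_gaussian_le`). With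
`s = t`, all errors are `O(t n) + O_t(tr A²)`, and `t` is arbitrary.
-/

/-! ### Exponential tilts of the single-spin law -/

/-- The logarithmic moment generating function `θ ↦ log ∫ exp (θ ⬝ᵥ z) dρ(z)`. -/
noncomputable def logMgf {N : ℕ} (ρ : Measure (Fin N → ℝ)) (θ : Fin N → ℝ) : ℝ :=
  Real.log (∫ z, Real.exp (θ ⬝ᵥ z) ∂ρ)

/-- The exponential tilt of `ρ` with external field `θ`. -/
noncomputable def spinTilt {N : ℕ} (ρ : Measure (Fin N → ℝ)) (θ : Fin N → ℝ) :
    Measure (Fin N → ℝ) :=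
  ρ.tilted fun z => θ ⬝ᵥ z

/-- The mean of the exponential tilt of `ρ` with external field `θ`. -/
noncomputable def tiltMean {N : ℕ} (ρ : Measure (Fin N → ℝ)) (θ : Fin N → ℝ) : Fin N → ℝ :=
  ∫ z, z ∂(spinTilt ρ θ)

section SingleSite

variable {N : ℕ} {ρ ν : Measure (Fin N → ℝ)} {R : ℝ}

@[fun_prop]
lemma continuous_dotProduct_left (θ : Fin N → ℝ) : Continuous fun z : Fin N → ℝ => θ ⬝ᵥ z := by
  unfold dotProduct; fun_prop

lemma abs_dotProduct_le (θ : Fin N → ℝ) {z : Fin N → ℝ} (hz : ∀ k, |z k| ≤ R) :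
    |θ ⬝ᵥ z| ≤ (∑ k, |θ k|) * R := by
  unfold dotProduct
  rw [Finset.sum_mul]
  refine (Finset.abs_sum_le_sum_abs _ _).trans (Finset.sum_le_sum fun k _ => ?_)
  rw [abs_mul]
  exact mul_le_mul_of_nonneg_left (hz k) (abs_nonneg _)

lemma integrable_dotProduct [IsFiniteMeasure ν] (hb : ∀ᵐ z ∂ν, ∀ k, |z k| ≤ R)
    (θ : Fin N → ℝ) : Integrable (fun z => θ ⬝ᵥ z) ν :=
  Integrable.of_bound (continuous_dotProduct_left θ).aestronglyMeasurable _
    (hb.mono fun _ hz => abs_dotProduct_le θ hz)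

lemma integrable_exp_dotProduct [IsFiniteMeasure ν] (hb : ∀ᵐ z ∂ν, ∀ k, |z k| ≤ R)
    (θ : Fin N → ℝ) : Integrable (fun z => Real.exp (θ ⬝ᵥ z)) ν := by
  refine Integrable.of_bound
    (Real.continuous_exp.comp (continuous_dotProduct_left θ)).aestronglyMeasurable
    (Real.exp ((∑ k, |θ k|) * R)) (hb.mono fun z hz => ?_)
  rw [Real.norm_eq_abs, Real.abs_exp]
  exact Real.exp_le_exp.2 ((le_abs_self _).trans (abs_dotProduct_le θ hz))

lemma integrable_coord [IsFiniteMeasure ν] (hb : ∀ᵐ z ∂ν, ∀ k, |z k| ≤ R) (k : Fin N) :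
    Integrable (fun z : Fin N → ℝ => z k) ν :=
  Integrable.of_bound (continuous_apply k).aestronglyMeasurable R (hb.mono fun _ hz => hz k)

lemma mean_apply [IsFiniteMeasure ν] (hb : ∀ᵐ z ∂ν, ∀ k, |z k| ≤ R) (k : Fin N) :
    (∫ z, z ∂ν) k = ∫ z, z k ∂ν :=
  eval_integral (fun j => integrable_coord hb j) k

lemma abs_mean_le [IsProbabilityMeasure ν] (hb : ∀ᵐ z ∂ν, ∀ k, |z k| ≤ R) (k : Fin N) :
    |(∫ z, z ∂ν) k| ≤ R := by
  rw [mean_apply hb]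
  have := norm_integral_le_of_norm_le_const (μ := ν) (f := fun z : Fin N → ℝ => z k) (C := R)
    (hb.mono fun _ hz => hz k)
  simpa using this

lemma integral_dotProduct [IsFiniteMeasure ν] (hb : ∀ᵐ z ∂ν, ∀ k, |z k| ≤ R)
    (θ : Fin N → ℝ) : ∫ z, θ ⬝ᵥ z ∂ν = θ ⬝ᵥ ∫ z, z ∂ν := by
  unfold dotProduct
  rw [integral_finsetSum _ fun k _ => (integrable_coord hb k).const_mul _]
  exact Finset.sum_congr rfl fun k _ => by rw [integral_const_mul, mean_apply hb]

lemma spinTilt_absolutelyContinuous (ρ : Measure (Fin N → ℝ)) (θ : Fin N → ℝ) :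
    spinTilt ρ θ ≪ ρ :=
  tilted_absolutelyContinuous _ _

lemma spinTilt_ae_bound (hb : ∀ᵐ z ∂ρ, ∀ k, |z k| ≤ R) (θ : Fin N → ℝ) :
    ∀ᵐ z ∂(spinTilt ρ θ), ∀ k, |z k| ≤ R :=
  (spinTilt_absolutelyContinuous ρ θ).ae_le hb

lemma restrict_Icc_eq_self (hb : ∀ᵐ z ∂ρ, ∀ k, |z k| ≤ R) :
    ρ.restrict (Set.Icc (fun _ => -R) fun _ => R) = ρ :=
  Measure.restrict_eq_self_of_ae_mem (hb.mono fun _ hz =>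
    ⟨fun k => (abs_le.1 (hz k)).1, fun k => (abs_le.1 (hz k)).2⟩)

variable [IsProbabilityMeasure ρ]

lemma isProbabilityMeasure_spinTilt (hb : ∀ᵐ z ∂ρ, ∀ k, |z k| ≤ R) (θ : Fin N → ℝ) :
    IsProbabilityMeasure (spinTilt ρ θ) :=
  isProbabilityMeasure_tilted (integrable_exp_dotProduct hb θ)

lemma abs_tiltMean_le (hb : ∀ᵐ z ∂ρ, ∀ k, |z k| ≤ R) (θ : Fin N → ℝ) (k : Fin N) :
    |tiltMean ρ θ k| ≤ R :=
  have := isProbabilityMeasure_spinTilt hb θ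
  abs_mean_le (spinTilt_ae_bound hb θ) k

lemma integral_exp_dotProduct_pos (hb : ∀ᵐ z ∂ρ, ∀ k, |z k| ≤ R) (θ : Fin N → ℝ) :
    0 < ∫ z, Real.exp (θ ⬝ᵥ z) ∂ρ :=
  integral_exp_pos (integrable_exp_dotProduct hb θ)

lemma exp_logMgf (hb : ∀ᵐ z ∂ρ, ∀ k, |z k| ≤ R) (θ : Fin N → ℝ) :
    Real.exp (logMgf ρ θ) = ∫ z, Real.exp (θ ⬝ᵥ z) ∂ρ :=
  Real.exp_log (integral_exp_dotProduct_pos hb θ)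

/-- Gibbs' variational inequality: relative entropy dominates the Legendre transform of the
logarithmic moment generating function at the mean. -/
lemma dotProduct_mean_sub_logMgf_le_klDiv [IsProbabilityMeasure ν]
    (hb : ∀ᵐ z ∂ρ, ∀ k, |z k| ≤ R) (hν : InformationTheory.klDiv ν ρ ≠ ⊤) (θ : Fin N → ℝ) :
    θ ⬝ᵥ (∫ z, z ∂ν) - logMgf ρ θ ≤ (InformationTheory.klDiv ν ρ).toReal := by
  obtain ⟨hac, hint⟩ := InformationTheory.klDiv_ne_top_iff.1 hν
  have hbν : ∀ᵐ z ∂ν, ∀ k, |z k| ≤ R := hac.ae_le hb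
  have hexp := integrable_exp_dotProduct hb θ
  have := isProbabilityMeasure_spinTilt hb θ
  have hac' : ν ≪ spinTilt ρ θ := hac.trans (absolutelyContinuous_tilted hexp)
  have hint' : Integrable (llr ν (spinTilt ρ θ)) ν :=
    integrable_llr_tilted_right hac (integrable_dotProduct hbν θ) hint hexp
  have h1 := InformationTheory.integral_llr_add_sub_measure_univ_nonneg hac' hint'
  have h2 := integral_llr_tilted_right hac (integrable_dotProduct hbν θ) hexp hint
  rw [InformationTheory.toReal_klDiv_of_measure_eq hac (by simp)]
  rw [spinTilt, h2, integral_dotProduct hbν] at h1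
  have h3 : (ρ.tilted fun z => θ ⬝ᵥ z).real Set.univ = 1 := probReal_univ (μ := spinTilt ρ θ)
  rw [h3, probReal_univ] at h1
  unfold logMgf
  linarith

/-- Exponential tilts attain equality in Gibbs' variational inequality. -/
lemma klDiv_spinTilt (hb : ∀ᵐ z ∂ρ, ∀ k, |z k| ≤ R) (θ : Fin N → ℝ) :
    InformationTheory.klDiv (spinTilt ρ θ) ρ ≠ ⊤ ∧
    (InformationTheory.klDiv (spinTilt ρ θ) ρ).toReal
      = θ ⬝ᵥ tiltMean ρ θ - logMgf ρ θ := by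
  have := isProbabilityMeasure_spinTilt hb θ
  have hbt := spinTilt_ae_bound hb θ
  have hexp := integrable_exp_dotProduct hb θ
  have hac := spinTilt_absolutelyContinuous ρ θ
  have hllr : llr (spinTilt ρ θ) ρ =ᵐ[spinTilt ρ θ] fun z => θ ⬝ᵥ z - logMgf ρ θ :=
    hac.ae_le (log_rnDeriv_tilted_left_self hexp)
  have hint : Integrable (llr (spinTilt ρ θ) ρ) (spinTilt ρ θ) :=
    (integrable_congr hllr).2 ((integrable_dotProduct hbt θ).sub (integrable_const _))
  refine ⟨InformationTheory.klDiv_ne_top hac hint, ?_⟩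
  rw [InformationTheory.toReal_klDiv_of_measure_eq hac (by simp), integral_congr_ae hllr,
    integral_sub (integrable_dotProduct hbt θ) (integrable_const _), integral_dotProduct hbt]
  simp [tiltMean]

lemma continuous_integral_exp_dotProduct (hb : ∀ᵐ z ∂ρ, ∀ k, |z k| ≤ R) :
    Continuous fun θ : Fin N → ℝ => ∫ z, Real.exp (θ ⬝ᵥ z) ∂ρ := by
  have h := continuous_parametric_integral_of_continuous (μ := ρ)
    (f := fun θ z : Fin N → ℝ => Real.exp (θ ⬝ᵥ z))
    (by unfold dotProduct Function.uncurry; fun_prop)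
    (isCompact_Icc (a := fun _ : Fin N => -R) (b := fun _ => R))
  rwa [restrict_Icc_eq_self hb] at h

lemma continuous_logMgf (hb : ∀ᵐ z ∂ρ, ∀ k, |z k| ≤ R) : Continuous (logMgf ρ) :=
  (continuous_integral_exp_dotProduct hb).log fun θ => (integral_exp_dotProduct_pos hb θ).ne'

lemma continuous_tiltMean (hb : ∀ᵐ z ∂ρ, ∀ k, |z k| ≤ R) : Continuous (tiltMean ρ) := by
  have h := continuous_parametric_integral_of_continuous (μ := ρ)
    (f := fun θ z : Fin N → ℝ => Real.exp (θ ⬝ᵥ z) • z)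
    (by unfold dotProduct Function.uncurry; fun_prop)
    (isCompact_Icc (a := fun _ : Fin N => -R) (b := fun _ => R))
  rw [restrict_Icc_eq_self hb] at h
  have h2 : tiltMean ρ = fun θ => (∫ z, Real.exp (θ ⬝ᵥ z) ∂ρ)⁻¹ •
      ∫ z, Real.exp (θ ⬝ᵥ z) • z ∂ρ := by
    ext1 θ
    rw [tiltMean, spinTilt, integral_tilted, ← integral_smul]
    congr 1 with z : 1
    rw [smul_smul, div_eq_inv_mul]
  rw [h2]
  exact ((continuous_integral_exp_dotProduct hb).inv₀
    fun θ => (integral_exp_dotProduct_pos hb θ).ne').smul h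

/-- The derivative of the logarithmic moment generating function is the tilted mean. -/
lemma hasDerivAt_logMgf_line (hb : ∀ᵐ z ∂ρ, ∀ k, |z k| ≤ R) (θ v : Fin N → ℝ) :
    HasDerivAt (fun t : ℝ => logMgf ρ (θ + t • v)) (v ⬝ᵥ tiltMean ρ θ) 0 := by
  have := isProbabilityMeasure_spinTilt hb θ
  have hbt := spinTilt_ae_bound hb θ
  have hset : integrableExpSet (fun z : Fin N → ℝ => v ⬝ᵥ z) (spinTilt ρ θ) = Set.univ := by
    ext t
    simp only [integrableExpSet, Set.mem_ofPred_eq, Set.mem_univ, iff_true]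
    simpa [smul_dotProduct] using integrable_exp_dotProduct hbt (t • v)
  have h0 : (0 : ℝ) ∈ interior (integrableExpSet (fun z : Fin N → ℝ => v ⬝ᵥ z) (spinTilt ρ θ)) := by
    simp [hset]
  have hd : HasDerivAt (cgf (fun z : Fin N → ℝ => v ⬝ᵥ z) (spinTilt ρ θ))
      (v ⬝ᵥ tiltMean ρ θ) 0 := by
    have h1 := (analyticAt_cgf h0).differentiableAt.hasDerivAt
    rw [deriv_cgf_zero h0] at h1
    simpa [integral_dotProduct hbt, tiltMean] using h1
  refine (hd.const_add (logMgf ρ θ)).congr_of_eventuallyEq (Eventually.of_forall fun t => ?_)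
  have h2 : mgf (fun z : Fin N → ℝ => v ⬝ᵥ z) (spinTilt ρ θ) t
      = (∫ z, Real.exp ((θ + t • v) ⬝ᵥ z) ∂ρ) / ∫ z, Real.exp (θ ⬝ᵥ z) ∂ρ := by
    rw [mgf, spinTilt, integral_exp_tilted]
    congr 2 with z
    simp [add_dotProduct, smul_dotProduct]
  simp only [cgf, h2, logMgf]
  rw [Real.log_div (integral_exp_dotProduct_pos hb _).ne' (integral_exp_dotProduct_pos hb _).ne']
  ring

lemma neg_le_logMgf (hb : ∀ᵐ z ∂ρ, ∀ k, |z k| ≤ R) (θ : Fin N → ℝ) :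
    -((∑ k, |θ k|) * R) ≤ logMgf ρ θ := by
  rw [logMgf, Real.le_log_iff_exp_le (integral_exp_dotProduct_pos hb θ)]
  calc Real.exp (-((∑ k, |θ k|) * R)) = ∫ _, Real.exp (-((∑ k, |θ k|) * R)) ∂ρ := by simp
    _ ≤ _ := integral_mono_ae (integrable_const _) (integrable_exp_dotProduct hb θ)
      (hb.mono fun z hz => Real.exp_le_exp.2 (abs_le.1 (abs_dotProduct_le θ hz)).1)

/-- The field `θ` is the minimiser of `θ ↦ logMgf ρ θ + |l - θ|² / (2 L)`, the convex dual of
maximising `l ⬝ᵥ m(ν) - L / 2 |m(ν)|² - D(ν ‖ ρ)`. -/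
lemma exists_add_smul_tiltMean_eq (hb : ∀ᵐ z ∂ρ, ∀ k, |z k| ≤ R) {L : ℝ} (hL : 0 < L)
    (l : Fin N → ℝ) : ∃ θ, θ + L • tiltMean ρ θ = l := by
  let g : (Fin N → ℝ) → ℝ := fun θ => logMgf ρ θ + 1 / (2 * L) * ∑ k, (l k - θ k) ^ 2
  have hg : Continuous g := by
    have := continuous_logMgf hb
    fun_prop
  -- the dual function grows at least linearly, because its quadratic term beats `logMgf ρ`
  have hlow : ∀ θ, ‖θ‖ + -∑ k, ((|R| + 1) * |l k| + L * (|R| + 1) ^ 2 / 2) ≤ g θ := by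
    intro θ
    have h1 := neg_le_logMgf hb θ
    have h2 : (∑ k, |θ k|) * R ≤ ∑ k, |θ k| * |R| := by
      rw [← Finset.sum_mul]
      exact mul_le_mul_of_nonneg_left (le_abs_self R) (Finset.sum_nonneg fun k _ => abs_nonneg _)
    have h3 : ∑ k, (|θ k| - ((|R| + 1) * |l k| + L * (|R| + 1) ^ 2 / 2))
        ≤ ∑ k, (1 / (2 * L) * (l k - θ k) ^ 2 - |θ k| * |R|) := by
      refine Finset.sum_le_sum fun k _ => ?_
      have h4 : |θ k| - |l k| ≤ |l k - θ k| := by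
        rw [abs_sub_comm]; exact abs_sub_abs_le_abs_sub _ _
      have h5 : (|R| + 1) * |l k - θ k| - L * (|R| + 1) ^ 2 / 2
          ≤ 1 / (2 * L) * (l k - θ k) ^ 2 := by
        have h6 : 0 ≤ 1 / (2 * L) * (|l k - θ k| - L * (|R| + 1)) ^ 2 := by positivity
        have h7 : 1 / (2 * L) * (|l k - θ k| - L * (|R| + 1)) ^ 2 = 1 / (2 * L) * (l k - θ k) ^ 2
            - (|R| + 1) * |l k - θ k| + L * (|R| + 1) ^ 2 / 2 := by
          rw [← sq_abs (l k - θ k)]; field_simp; ring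
        linarith
      have h8 := mul_le_mul_of_nonneg_left h4 (by positivity : 0 ≤ |R| + 1)
      linarith
    have h9 : ‖θ‖ ≤ ∑ k, |θ k| :=
      (pi_norm_le_iff_of_nonneg (Finset.sum_nonneg fun k _ => abs_nonneg _)).2 fun k =>
        Finset.single_le_sum (f := fun k => |θ k|) (fun j _ => abs_nonneg _) (Finset.mem_univ k)
    rw [Finset.sum_sub_distrib, Finset.sum_sub_distrib, ← Finset.mul_sum] at h3
    simp only [g]
    linarith
  have hcoer : Tendsto g (cocompact (Fin N → ℝ)) atTop :=
    tendsto_atTop_mono hlow (tendsto_atTop_add_const_right _ _ (tendsto_norm_cocompact_atTop))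
  obtain ⟨θ, hθ⟩ := hg.exists_forall_le hcoer
  refine ⟨θ, funext fun k => ?_⟩
  have hd := hasDerivAt_logMgf_line hb θ (Pi.single k 1)
  have hd2 : HasDerivAt (fun t : ℝ => g (θ + t • Pi.single k 1))
      (tiltMean ρ θ k + 1 / (2 * L) * (-2 * (l k - θ k))) 0 := by
    rw [single_dotProduct, one_mul] at hd
    refine hd.add (HasDerivAt.const_mul _ ?_)
    have : HasDerivAt (fun t : ℝ => ∑ j, (l j - (θ + t • (Pi.single k 1 : Fin N → ℝ)) j) ^ 2)
        (∑ j, -2 * (l j - θ j) * (Pi.single k 1 : Fin N → ℝ) j) 0 := by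
      refine HasDerivAt.fun_sum fun j _ => ?_
      have h1 : HasDerivAt (fun t : ℝ => l j - (θ j + t * (Pi.single k 1 : Fin N → ℝ) j))
          (-(1 * (Pi.single k 1 : Fin N → ℝ) j)) 0 :=
        (((hasDerivAt_id (0 : ℝ)).mul_const _).const_add (θ j)).const_sub (l j)
      refine (h1.fun_pow 2).congr_deriv ?_
      simp
    simpa [Pi.single_apply] using this
  have hmin : IsLocalMin (fun t : ℝ => g (θ + t • (Pi.single k 1 : Fin N → ℝ))) 0 :=
    Eventually.of_forall fun t => by simpa using hθ _
  have hz := hmin.hasDerivAt_eq_zero hd2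
  simp only [Pi.add_apply, Pi.smul_apply, smul_eq_mul]
  field_simp at hz
  linarith

end SingleSite

/-! ### Product measures and the mean-field equation -/

/-- The Euclidean inner product of two configurations. -/
def configInner {N n : ℕ} (x y : Fin n → Fin N → ℝ) : ℝ := ∑ i, x i ⬝ᵥ y i

/-- The means of the tilts of `ρ` with external fields `θ 1, …, θ n`. -/
noncomputable def configMean {N n : ℕ} (ρ : Measure (Fin N → ℝ)) (θ : Fin n → Fin N → ℝ) :
    Fin n → Fin N → ℝ :=
  fun i => tiltMean ρ (θ i)

/-- The relative entropy `∑ i, (θ i ⬝ᵥ m (θ i) - logMgf ρ (θ i))` of the product of the tilts of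
`ρ` with external fields `θ 1, …, θ n`. -/
noncomputable def tiltEntropy {N n : ℕ} (ρ : Measure (Fin N → ℝ)) (θ : Fin n → Fin N → ℝ) : ℝ :=
  ∑ i, (θ i ⬝ᵥ tiltMean ρ (θ i) - logMgf ρ (θ i))

section Product

variable {N n : ℕ} {ρ : Measure (Fin N → ℝ)} {R : ℝ}

lemma configInner_add_left (x y z : Fin n → Fin N → ℝ) :
    configInner (x + y) z = configInner x z + configInner y z := by
  simp [configInner, add_dotProduct, Finset.sum_add_distrib]

lemma configInner_sub_right (x y z : Fin n → Fin N → ℝ) :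
    configInner x (y - z) = configInner x y - configInner x z := by
  simp [configInner, dotProduct_sub, Finset.sum_sub_distrib]

lemma configInner_smul_left (c : ℝ) (x y : Fin n → Fin N → ℝ) :
    configInner (c • x) y = c * configInner x y := by
  simp [configInner, smul_dotProduct, Finset.mul_sum]

lemma configInner_self_nonneg (x : Fin n → Fin N → ℝ) : 0 ≤ configInner x x :=
  Finset.sum_nonneg fun i _ => Finset.sum_nonneg fun k _ => mul_self_nonneg (x i k)

lemma eq_zero_of_configInner_self_nonpos {x : Fin n → Fin N → ℝ} (hx : configInner x x ≤ 0) :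
    x = 0 := by
  have h0 := le_antisymm hx (configInner_self_nonneg x)
  have h1 : ∀ i, 0 ≤ x i ⬝ᵥ x i := fun i => Finset.sum_nonneg fun k _ => mul_self_nonneg (x i k)
  rw [configInner, Finset.sum_eq_zero_iff_of_nonneg fun i _ => h1 i] at h0
  exact funext fun i => dotProduct_self_eq_zero.1 (h0 i (Finset.mem_univ i))

lemma configInner_self_le {x : Fin n → Fin N → ℝ} {r : ℝ} (hx : ∀ i k, |x i k| ≤ r) :
    configInner x x ≤ n * (N * r ^ 2) := by
  have h : ∀ i, x i ⬝ᵥ x i ≤ N * r ^ 2 := fun i => by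
    calc x i ⬝ᵥ x i ≤ ∑ _k : Fin N, r ^ 2 := Finset.sum_le_sum fun k _ => by
          rw [← sq, ← sq_abs]; exact pow_le_pow_left₀ (abs_nonneg _) (hx i k) 2
      _ = N * r ^ 2 := by simp
  calc configInner x x ≤ ∑ _i : Fin n, N * r ^ 2 := Finset.sum_le_sum fun i _ => h i
    _ = n * (N * r ^ 2) := by simp

@[fun_prop]
lemma continuous_configInner_left (θ : Fin n → Fin N → ℝ) :
    Continuous fun x : Fin n → Fin N → ℝ => configInner θ x := by
  unfold configInner dotProduct; fun_prop

variable [IsProbabilityMeasure ρ]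

lemma tiltEntropy_eq (ρ : Measure (Fin N → ℝ)) (θ : Fin n → Fin N → ℝ) :
    tiltEntropy ρ θ = configInner θ (configMean ρ θ) - ∑ i, logMgf ρ (θ i) := by
  simp [tiltEntropy, configInner, configMean, Finset.sum_sub_distrib]

lemma tiltEntropy_eq_sum_klDiv (hb : ∀ᵐ z ∂ρ, ∀ k, |z k| ≤ R) (θ : Fin n → Fin N → ℝ) :
    tiltEntropy ρ θ = ∑ i, (InformationTheory.klDiv (spinTilt ρ (θ i)) ρ).toReal :=
  Finset.sum_congr rfl fun i _ => ((klDiv_spinTilt hb (θ i)).2).symm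

lemma configInner_sub_le_sum_klDiv (hb : ∀ᵐ z ∂ρ, ∀ k, |z k| ≤ R)
    {ν : Fin n → Measure (Fin N → ℝ)} (hν : ∀ i, IsProbabilityMeasure (ν i))
    (hkl : ∀ i, InformationTheory.klDiv (ν i) ρ ≠ ⊤) (θ : Fin n → Fin N → ℝ) :
    configInner θ (meanVector ν) - ∑ i, logMgf ρ (θ i)
      ≤ ∑ i, (InformationTheory.klDiv (ν i) ρ).toReal := by
  rw [configInner, ← Finset.sum_sub_distrib]
  exact Finset.sum_le_sum fun i _ => dotProduct_mean_sub_logMgf_le_klDiv hb (hkl i) (θ i)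

/-- A semiconvex mean-field functional `Ψ (m(ν)) - ∑ i, D(ν i ‖ ρ)` is maximised over product
measures by a product of tilts whose fields `θ` solve the mean-field equation
`θ = ∇Ψ (m(θ))`.

Given any `ν` with mean `a`, the concave minorant `Ψ a + ⟨G a, x - a⟩ - L / 2 |x - a|²` of `Ψ` is a
sum over sites, so that its mean-field functional is maximised, site by site, by tilts with fields
`θ' = G a + L (a - m(θ'))`. These fields range over a compact set. Replacing a maximiser by such
fields would increase the functional by `L / 2 |m(θ') - a|²`, whence `m(θ') = a`. -/
lemma exists_meanField_maximizer (hb : ∀ᵐ z ∂ρ, ∀ k, |z k| ≤ R)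
    {Ψ : (Fin n → Fin N → ℝ) → ℝ} {G : (Fin n → Fin N → ℝ) → Fin n → Fin N → ℝ} {L : ℝ}
    (hΨ : Continuous Ψ) (hG : Continuous G) (hL : 0 < L)
    (hmin : ∀ a x, Ψ a + configInner (G a) (x - a) - L / 2 * configInner (x - a) (x - a) ≤ Ψ x) :
    ∃ θ, θ = G (configMean ρ θ) ∧
      ∀ ν : Fin n → Measure (Fin N → ℝ), (∀ i, IsProbabilityMeasure (ν i)) →
        (∀ i, InformationTheory.klDiv (ν i) ρ ≠ ⊤) →
        Ψ (meanVector ν) - ∑ i, (InformationTheory.klDiv (ν i) ρ).toReal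
          ≤ Ψ (configMean ρ θ) - tiltEntropy ρ θ := by
  have hm : Continuous (configMean ρ : (Fin n → Fin N → ℝ) → Fin n → Fin N → ℝ) := by
    have := continuous_tiltMean hb
    unfold configMean; fun_prop
  have hV : Continuous fun θ : Fin n → Fin N → ℝ => Ψ (configMean ρ θ) - tiltEntropy ρ θ := by
    have h1 := continuous_tiltMean hb
    have h2 := continuous_logMgf hb
    unfold tiltEntropy dotProduct
    fun_prop
  let K : Set (Fin n → Fin N → ℝ) := Set.Icc (fun _ _ => -R) fun _ _ => R
  have hK : IsCompact K := isCompact_Icc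
  have hmemK : ∀ a : Fin n → Fin N → ℝ, (∀ i k, |a i k| ≤ R) → a ∈ K := fun a ha =>
    ⟨fun i k => (abs_le.1 (ha i k)).1, fun i k => (abs_le.1 (ha i k)).2⟩
  have hmK : ∀ θ, configMean ρ θ ∈ K := fun θ =>
    hmemK _ fun i k => abs_tiltMean_le hb (θ i) k
  let S := (fun p : (Fin n → Fin N → ℝ) × (Fin n → Fin N → ℝ) =>
    G p.1 + L • p.1 - L • p.2) '' (K ×ˢ K)
  have hS : IsCompact S := (hK.prod hK).image (by fun_prop)
  -- the site-by-site improvement of an arbitrary product measure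
  have himp : ∀ ν : Fin n → Measure (Fin N → ℝ), (∀ i, IsProbabilityMeasure (ν i)) →
      (∀ i, InformationTheory.klDiv (ν i) ρ ≠ ⊤) → ∃ θ' ∈ S,
        θ' = G (meanVector ν) - L • (configMean ρ θ' - meanVector ν) ∧
        Ψ (meanVector ν) - ∑ i, (InformationTheory.klDiv (ν i) ρ).toReal
          + L / 2 * configInner (configMean ρ θ' - meanVector ν) (configMean ρ θ' - meanVector ν)
          ≤ Ψ (configMean ρ θ') - tiltEntropy ρ θ' := by
    intro ν hν hkl
    set a := meanVector ν with ha
    have haK : a ∈ K := hmemK _ fun i k => by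
      have hac := (InformationTheory.klDiv_ne_top_iff.1 (hkl i)).1
      exact abs_mean_le (hac.ae_le hb) k
    choose θ' hθ' using fun i => exists_add_smul_tiltMean_eq hb hL ((G a + L • a) i)
    have heq : θ' = G a + L • a - L • configMean ρ θ' := by
      ext1 i
      exact eq_sub_of_add_eq (hθ' i)
    have heq2 : θ' = G a - L • (configMean ρ θ' - a) := by
      rw [smul_sub]; nth_rw 1 [heq]; abel
    refine ⟨θ', ⟨(a, configMean ρ θ'), ⟨haK, hmK θ'⟩, heq.symm⟩, heq2, ?_⟩
    have h1 := hmin a (configMean ρ θ')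
    have h2 := configInner_sub_le_sum_klDiv hb hν hkl θ'
    have h3 : configInner (G a) (configMean ρ θ' - a) = configInner θ' (configMean ρ θ' - a)
        + L * configInner (configMean ρ θ' - a) (configMean ρ θ' - a) := by
      have : G a = θ' + L • (configMean ρ θ' - a) := by
        nth_rw 1 [heq2]; abel
      rw [← configInner_smul_left]
      nth_rw 1 [this]
      rw [configInner_add_left]
    rw [tiltEntropy_eq]
    rw [configInner_sub_right θ'] at h3
    linarith
  have htilt : ∀ θ : Fin n → Fin N → ℝ,
      meanVector (fun i => spinTilt ρ (θ i)) = configMean ρ θ := fun _ => rfl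
  have hSne : S.Nonempty := ⟨_, ⟨(configMean ρ 0, configMean ρ 0), ⟨hmK 0, hmK 0⟩, rfl⟩⟩
  obtain ⟨θ₁, -, hmax⟩ := hS.exists_isMaxOn hSne hV.continuousOn
  obtain ⟨θ, hθS, hθ, hle⟩ := himp (fun i => spinTilt ρ (θ₁ i))
    (fun i => isProbabilityMeasure_spinTilt hb (θ₁ i)) fun i => (klDiv_spinTilt hb (θ₁ i)).1
  rw [htilt, ← tiltEntropy_eq_sum_klDiv hb] at hle
  rw [htilt] at hθ
  have hle' : Ψ (configMean ρ θ) - tiltEntropy ρ θ ≤ Ψ (configMean ρ θ₁) - tiltEntropy ρ θ₁ :=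
    hmax hθS
  have hzero : configMean ρ θ - configMean ρ θ₁ = 0 := by
    apply eq_zero_of_configInner_self_nonpos
    by_contra! hpos
    have := mul_pos (half_pos hL) hpos
    linarith
  refine ⟨θ, ?_, fun ν hν hkl => ?_⟩
  · rw [hzero, smul_zero, sub_zero, ← sub_eq_zero.1 hzero] at hθ
    exact hθ
  · obtain ⟨θ', hθ'S, -, h'⟩ := himp ν hν hkl
    have h1 : Ψ (configMean ρ θ') - tiltEntropy ρ θ' ≤ Ψ (configMean ρ θ₁) - tiltEntropy ρ θ₁ :=
      hmax hθ'S
    have h2 := mul_nonneg (half_pos hL).le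
      (configInner_self_nonneg (configMean ρ θ' - meanVector ν))
    have h3 := mul_nonneg (half_pos hL).le
      (configInner_self_nonneg (configMean ρ θ - configMean ρ θ₁))
    linarith

/-- The product of the tilts of `ρ` is the tilt of the product measure. -/
lemma pi_spinTilt (hb : ∀ᵐ z ∂ρ, ∀ k, |z k| ≤ R) (θ : Fin n → Fin N → ℝ) :
    Measure.pi (fun i => spinTilt ρ (θ i))
      = (Measure.pi fun _ : Fin n => ρ).tilted (configInner θ) := by
  have := fun i => isProbabilityMeasure_spinTilt hb (θ i)
  refine Measure.pi_eq fun s hs => ?_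
  have hprod : ∀ x : Fin n → Fin N → ℝ,
      Real.exp (configInner θ x) = ∏ i, Real.exp (θ i ⬝ᵥ x i) := fun x => Real.exp_sum _ _
  have hset : (Measure.pi fun _ : Fin n => ρ).restrict (Set.univ.pi s)
      = Measure.pi fun i => ρ.restrict (s i) := Measure.restrict_pi_pi _ _
  rw [tilted_apply_eq_ofReal_integral' _ (MeasurableSet.univ_pi hs)]
  simp_rw [hprod]
  rw [integral_fintype_prod_eq_prod (fun i z => Real.exp (θ i ⬝ᵥ z)), hset, integral_div,
    integral_fintype_prod_eq_prod (fun i z => Real.exp (θ i ⬝ᵥ z)), ← Finset.prod_div_distrib,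
    ENNReal.ofReal_prod_of_nonneg]
  · refine Finset.prod_congr rfl fun i _ => ?_
    rw [spinTilt, tilted_apply_eq_ofReal_integral' _ (hs i), integral_div]
  · intro i _
    exact div_nonneg (integral_nonneg fun _ => (Real.exp_pos _).le)
      (integral_nonneg fun _ => (Real.exp_pos _).le)

lemma integral_exp_configInner (hb : ∀ᵐ z ∂ρ, ∀ k, |z k| ≤ R) (θ : Fin n → Fin N → ℝ) :
    ∫ x, Real.exp (configInner θ x) ∂(Measure.pi fun _ : Fin n => ρ)
      = Real.exp (∑ i, logMgf ρ (θ i)) := by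
  have hprod : ∀ x : Fin n → Fin N → ℝ,
      Real.exp (configInner θ x) = ∏ i, Real.exp (θ i ⬝ᵥ x i) := fun x => Real.exp_sum _ _
  simp_rw [hprod, Real.exp_sum, exp_logMgf hb]
  exact integral_fintype_prod_eq_prod (fun i z => Real.exp (θ i ⬝ᵥ z))

lemma ae_pi_bound {ν : Fin n → Measure (Fin N → ℝ)} [∀ i, IsProbabilityMeasure (ν i)]
    (hb : ∀ i, ∀ᵐ z ∂(ν i), ∀ k, |z k| ≤ R) :
    ∀ᵐ x ∂(Measure.pi ν), ∀ i k, |x i k| ≤ R :=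
  ae_all_iff.2 fun i => (Measure.quasiMeasurePreserving_eval ν i).ae (hb i)

end Product

/-! ### Diagonalisation of the coupling -/

section Diagonalisation

lemma trace_sq_eq_sum_sq {m : Type*} [Fintype m] [DecidableEq m] {A : Matrix m m ℝ}
    (hA : A.IsSymm) : (A ^ 2).trace = ∑ i, ∑ j, A i j ^ 2 := by
  simp only [Matrix.trace, Matrix.diag_apply, sq, Matrix.mul_apply]
  exact Finset.sum_congr rfl fun i _ => Finset.sum_congr rfl fun j _ => by rw [hA.apply i j]

lemma sum_abs_diag_le {n : ℕ} {A : Matrix (Fin n) (Fin n) ℝ} (hA : A.IsSymm) {t : ℝ} (ht : 0 < t) :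
    ∑ i, |A i i| ≤ t * n + 1 / (4 * t) * (A ^ 2).trace := by
  have h1 : ∑ i, A i i ^ 2 ≤ (A ^ 2).trace := by
    rw [trace_sq_eq_sum_sq hA]
    exact Finset.sum_le_sum fun i _ =>
      Finset.single_le_sum (f := fun j => A i j ^ 2) (fun j _ => sq_nonneg _) (Finset.mem_univ i)
  calc ∑ i, |A i i| ≤ ∑ i, (t + 1 / (4 * t) * A i i ^ 2) := Finset.sum_le_sum fun i _ => by
        have h2 : 0 ≤ 1 / (4 * t) * (|A i i| - 2 * t) ^ 2 := by positivity
        have h3 : 1 / (4 * t) * (|A i i| - 2 * t) ^ 2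
            = t + 1 / (4 * t) * A i i ^ 2 - |A i i| := by
          rw [← sq_abs (A i i)]; field_simp; ring
        linarith
    _ = t * n + 1 / (4 * t) * ∑ i, A i i ^ 2 := by
        rw [Finset.sum_add_distrib, ← Finset.mul_sum]; simp [mul_comm]
    _ ≤ _ := by gcongr

/-- The coupling `A ⊗ J` of a vector spin model is diagonal, with eigenvalues `b p`, in suitable
orthonormal coordinates `V` on configuration space; `V'` is the adjoint of `V`. -/
lemma exists_diagonalisation {N n : ℕ} {J : Matrix (Fin N) (Fin N) ℝ} (hJ : J.IsSymm)
    {A : Matrix (Fin n) (Fin n) ℝ} (hA : A.IsSymm) :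
    ∃ (b : Fin n × Fin N → ℝ) (V : (Fin n → Fin N → ℝ) →ₗ[ℝ] (Fin n × Fin N → ℝ))
      (V' : (Fin n × Fin N → ℝ) →ₗ[ℝ] (Fin n → Fin N → ℝ)),
      (∀ w x, configInner (V' w) x = ∑ p, w p * V x p) ∧
      (∀ x, ∑ p, V x p ^ 2 = configInner x x) ∧
      (∀ x, ∑ i, ∑ j, A i j * (x i ⬝ᵥ (J *ᵥ x j)) = ∑ p, b p * V x p ^ 2) ∧
      ∑ p, b p ^ 2 = (A ^ 2).trace * (J ^ 2).trace := by
  classical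
  set B : Matrix (Fin n × Fin N) (Fin n × Fin N) ℝ := Matrix.kroneckerMap (· * ·) A J with hBdef
  have hB : B.IsHermitian := by
    rw [Matrix.IsHermitian, Matrix.conjTranspose_eq_transpose_of_trivial]
    ext p q
    simp [hBdef, hA.apply, hJ.apply]
  set U : Matrix (Fin n × Fin N) (Fin n × Fin N) ℝ := hB.eigenvectorUnitary.1 with hU
  set D : Matrix (Fin n × Fin N) (Fin n × Fin N) ℝ := Matrix.diagonal hB.eigenvalues with hD
  have hUU : U * Uᵀ = 1 := by
    have := (Matrix.mem_unitaryGroup_iff).1 hB.eigenvectorUnitary.2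
    rwa [Matrix.star_eq_conjTranspose, Matrix.conjTranspose_eq_transpose_of_trivial] at this
  have hUU' : Uᵀ * U = 1 := mul_eq_one_comm.1 hUU
  have hspec : B = U * D * Uᵀ := by
    have := hB.spectral_theorem
    rw [Unitary.conjStarAlgAut_apply] at this
    rw [this, ← Matrix.conjTranspose_eq_transpose_of_trivial]
    rfl
  let V : (Fin n → Fin N → ℝ) →ₗ[ℝ] (Fin n × Fin N → ℝ) :=
    Uᵀ.mulVecLin ∘ₗ (LinearEquiv.curry ℝ ℝ (Fin n) (Fin N)).symm.toLinearMap
  have hV : ∀ x, V x = Uᵀ *ᵥ Function.uncurry x := fun x => rfl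
  let V' : (Fin n × Fin N → ℝ) →ₗ[ℝ] (Fin n → Fin N → ℝ) :=
    (LinearEquiv.curry ℝ ℝ (Fin n) (Fin N)).toLinearMap ∘ₗ U.mulVecLin
  refine ⟨hB.eigenvalues, V, V', fun w x => ?_, fun x => ?_, fun x => ?_, ?_⟩
  · calc configInner (V' w) x = (U *ᵥ w) ⬝ᵥ Function.uncurry x := by
          rw [dotProduct, Fintype.sum_prod_type]
          rfl
      _ = w ⬝ᵥ V x := by
          rw [hV, Matrix.dotProduct_mulVec, Matrix.vecMul_transpose]
  · calc ∑ p, V x p ^ 2 = V x ⬝ᵥ V x := Finset.sum_congr rfl fun p _ => sq _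
      _ = Function.uncurry x ⬝ᵥ Function.uncurry x := by
        rw [hV, Matrix.dotProduct_mulVec, Matrix.vecMul_transpose, Matrix.mulVec_mulVec, hUU,
          Matrix.one_mulVec]
      _ = configInner x x := by
        simp [dotProduct, configInner, Fintype.sum_prod_type]
  · calc ∑ i, ∑ j, A i j * (x i ⬝ᵥ (J *ᵥ x j))
        = Function.uncurry x ⬝ᵥ (B *ᵥ Function.uncurry x) := by
          simp only [dotProduct, Matrix.mulVec, Fintype.sum_prod_type, Function.uncurry_apply_pair,
            hBdef, Matrix.kroneckerMap_apply, Finset.mul_sum]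
          refine Finset.sum_congr rfl fun i _ => ?_
          rw [Finset.sum_comm]
          refine Finset.sum_congr rfl fun k _ => Finset.sum_congr rfl fun j _ =>
            Finset.sum_congr rfl fun l _ => by ring
      _ = V x ⬝ᵥ (D *ᵥ V x) := by
          rw [hspec, hV, ← Matrix.mulVec_mulVec, ← Matrix.mulVec_mulVec, Matrix.dotProduct_mulVec,
            ← Matrix.mulVec_transpose]
      _ = _ := by
          simp only [hD, Matrix.mulVec_diagonal, dotProduct]
          exact Finset.sum_congr rfl fun p _ => by ring
  · have h1 : (B ^ 2).trace = (A ^ 2).trace * (J ^ 2).trace := by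
      rw [sq, hBdef, ← Matrix.mul_kronecker_mul, ← sq, ← sq, Matrix.trace_kronecker]
    have h2 : (B ^ 2).trace = (D ^ 2).trace := by
      have : B ^ 2 = U * (D ^ 2 * Uᵀ) := by
        calc B ^ 2 = U * (D * (Uᵀ * U) * D * Uᵀ) := by rw [sq, hspec]; simp only [Matrix.mul_assoc]
          _ = _ := by rw [hUU', Matrix.mul_one, sq]
      rw [this, Matrix.trace_mul_comm, Matrix.mul_assoc, hUU', Matrix.mul_one]
    rw [← h1, h2, hD, Matrix.diagonal_pow, Matrix.trace_diagonal]
    simp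

end Diagonalisation

/-! ### Gaussian integrals -/

section Gaussian

lemma integral_exp_sq_gaussianReal {r : ℝ} (hr : r < 1) :
    ∫ x, Real.exp (r / 2 * x ^ 2) ∂(gaussianReal 0 1) = √((1 - r)⁻¹) := by
  rw [integral_gaussianReal_eq_integral_smul one_ne_zero]
  have h : ∀ x : ℝ, gaussianPDFReal 0 1 x • Real.exp (r / 2 * x ^ 2)
      = (√(2 * Real.pi))⁻¹ * Real.exp (-((1 - r) / 2) * x ^ 2) := fun x => by
    rw [gaussianPDFReal_def, smul_eq_mul, mul_assoc, ← Real.exp_add]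
    congr 2
    · simp
    · simp; ring
  simp_rw [h]
  rw [integral_const_mul, integral_gaussian, ← Real.sqrt_inv, ← Real.sqrt_mul (by positivity)]
  congr 1
  have : 1 - r ≠ 0 := by linarith
  field_simp

lemma integrable_exp_sq_gaussianReal {r : ℝ} (hr : r < 1) :
    Integrable (fun x => Real.exp (r / 2 * x ^ 2)) (gaussianReal 0 1) := by
  refine not_imp_comm.1 integral_undef ?_
  rw [integral_exp_sq_gaussianReal hr]
  exact (Real.sqrt_pos.2 (inv_pos.2 (by linarith))).ne'

variable {d : Type*} [Fintype d]

/-- The Laplace transform of the standard Gaussian measure. -/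
lemma lintegral_exp_sum_mul_gaussian (u : d → ℝ) :
    ∫⁻ g, ENNReal.ofReal (Real.exp (∑ p, u p * g p)) ∂(Measure.pi fun _ : d => gaussianReal 0 1)
      = ENNReal.ofReal (Real.exp (1 / 2 * ∑ p, u p ^ 2)) := by
  simp_rw [Real.exp_sum]
  rw [← ofReal_integral_eq_lintegral_ofReal
    (Integrable.fintype_prod fun p => integrable_exp_mul_gaussianReal (u p))
    (ae_of_all _ fun g => Finset.prod_nonneg fun p _ => (Real.exp_pos _).le),
    integral_fintype_prod_eq_prod (fun p x => Real.exp (u p * x)), Finset.mul_sum, Real.exp_sum]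
  congr 1
  refine Finset.prod_congr rfl fun p _ => ?_
  have := congrFun (mgf_fun_id_gaussianReal (μ := 0) (v := 1)) (u p)
  rw [mgf] at this
  rw [this]
  congr 1
  simp; ring

/-- The exponential moment of the Gaussian quadratic form which bounds the fluctuations of the
Hubbard–Stratonovich field. -/
lemma lintegral_exp_sum_sq_gaussian_le (κ : d → ℝ) (hκ : ∀ p, 0 ≤ κ p) {s : ℝ} (hs : 0 < s) :
    ∫⁻ g, ENNReal.ofReal (Real.exp (∑ p, κ p / (κ p + s) / 2 * g p ^ 2))
        ∂(Measure.pi fun _ : d => gaussianReal 0 1)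
      ≤ ENNReal.ofReal (Real.exp (1 / (2 * s) * ∑ p, κ p)) := by
  have hr : ∀ p, κ p / (κ p + s) < 1 := fun p => by
    have := hκ p
    rw [div_lt_one (by linarith)]; linarith
  simp_rw [Real.exp_sum]
  rw [← ofReal_integral_eq_lintegral_ofReal
    (Integrable.fintype_prod fun p => integrable_exp_sq_gaussianReal (hr p))
    (ae_of_all _ fun g => Finset.prod_nonneg fun p _ => (Real.exp_pos _).le),
    integral_fintype_prod_eq_prod (fun p x => Real.exp (κ p / (κ p + s) / 2 * x ^ 2)),
    Finset.mul_sum, Real.exp_sum]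
  refine ENNReal.ofReal_le_ofReal (Finset.prod_le_prod
    (fun p _ => integral_nonneg fun _ => (Real.exp_pos _).le) fun p _ => ?_)
  rw [integral_exp_sq_gaussianReal (hr p), Real.sqrt_le_left (Real.exp_pos _).le,
    ← Real.exp_nat_mul]
  have h0 : κ p + s ≠ 0 := by have := hκ p; positivity
  have h1 : (1 - κ p / (κ p + s))⁻¹ = κ p / s + 1 := by
    have : 1 - κ p / (κ p + s) = s / (κ p + s) := by field_simp; ring
    rw [this]; field_simp
  have h2 : ((2 : ℕ) : ℝ) * (1 / (2 * s) * κ p) = κ p / s := by push_cast; field_simp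
  rw [h1, h2]
  exact Real.add_one_le_exp _

end Gaussian

/-! ### The upper bound -/

section UpperBound

variable {N n : ℕ} {ρ : Measure (Fin N → ℝ)} {R : ℝ}

/-- A quadratic mean-field functional has a maximiser which is a product of tilts. The function is
expanded around the mean of the maximiser, where its gradient is the field `θ` of the tilts. -/
lemma exists_quadratic_maximizer [IsProbabilityMeasure ρ] (hb : ∀ᵐ z ∂ρ, ∀ k, |z k| ≤ R)
    {V : (Fin n → Fin N → ℝ) →ₗ[ℝ] (Fin n × Fin N → ℝ)}
    {V' : (Fin n × Fin N → ℝ) →ₗ[ℝ] (Fin n → Fin N → ℝ)}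
    (hV' : ∀ w x, configInner (V' w) x = ∑ p, w p * V x p)
    (hV : ∀ x, ∑ p, V x p ^ 2 = configInner x x)
    (c : Fin n × Fin N → ℝ) (f : Fin n → Fin N → ℝ) {Ψ : (Fin n → Fin N → ℝ) → ℝ}
    (hΨ : ∀ x, Ψ x = 1 / 2 * ∑ p, c p * V x p ^ 2 + configInner f x) :
    ∃ θ, (∀ x, Ψ x = Ψ (configMean ρ θ) + configInner θ (x - configMean ρ θ)
        + 1 / 2 * ∑ p, c p * V (x - configMean ρ θ) p ^ 2) ∧
      ∀ ν : Fin n → Measure (Fin N → ℝ), (∀ i, IsProbabilityMeasure (ν i)) →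
        (∀ i, InformationTheory.klDiv (ν i) ρ ≠ ⊤) →
        Ψ (meanVector ν) - ∑ i, (InformationTheory.klDiv (ν i) ρ).toReal
          ≤ Ψ (configMean ρ θ) - tiltEntropy ρ θ := by
  have hVc : Continuous V := V.continuous_of_finiteDimensional
  have hV'c : Continuous V' := V'.continuous_of_finiteDimensional
  let G : (Fin n → Fin N → ℝ) → Fin n → Fin N → ℝ := fun a => V' (fun p => c p * V a p) + f
  have hexp : ∀ a x, Ψ x = Ψ a + configInner (G a) (x - a)
      + 1 / 2 * ∑ p, c p * V (x - a) p ^ 2 := by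
    intro a x
    simp only [G, configInner_add_left, hV', hΨ, map_sub, Pi.sub_apply, configInner_sub_right]
    have h1 : ∑ p, c p * V x p ^ 2 = ∑ p, c p * V a p ^ 2
        + 2 * (∑ p, c p * V a p * V x p - ∑ p, c p * V a p * V a p)
        + ∑ p, c p * (V x p - V a p) ^ 2 := by
      rw [← Finset.sum_sub_distrib, Finset.mul_sum, ← Finset.sum_add_distrib,
        ← Finset.sum_add_distrib]
      exact Finset.sum_congr rfl fun p _ => by ring
    rw [h1]; ring
  have hΨc : Continuous Ψ := by
    rw [funext hΨ]; fun_prop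
  have hGc : Continuous G := by fun_prop
  -- `∑ p, |c p|` bounds the eigenvalues of the quadratic form; `1` is added for positivity
  have hL : 0 < ∑ p, |c p| + 1 := by positivity
  obtain ⟨θ, hθ, hmax⟩ := exists_meanField_maximizer hb hΨc hGc hL fun a x => by
    rw [hexp a x, ← hV]
    have h1 : ∑ p, -(∑ q, |c q| + 1) * V (x - a) p ^ 2 ≤ ∑ p, c p * V (x - a) p ^ 2 := by
      refine Finset.sum_le_sum fun p _ => mul_le_mul_of_nonneg_right ?_ (sq_nonneg _)
      have h2 := Finset.single_le_sum (f := fun q => |c q|) (fun q _ => abs_nonneg _)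
        (Finset.mem_univ p)
      have h3 := neg_abs_le (c p)
      linarith
    rw [← Finset.mul_sum] at h1
    linarith
  refine ⟨θ, fun x => ?_, hmax⟩
  nth_rw 2 [hθ]
  exact hexp _ x

/-- Upper bound for the partition function in a Hubbard–Stratonovich field `g`. The quadratic form
`b` is lowered by `b² / (2 t)`, which leaves a form bounded above by `t / 2`, so that the exponent
is almost dominated by its linearisation at the mean of a solution of the mean-field equation. -/
lemma lintegral_exp_field_le [IsProbabilityMeasure ρ] (hb : ∀ᵐ z ∂ρ, ∀ k, |z k| ≤ R)
    {V : (Fin n → Fin N → ℝ) →ₗ[ℝ] (Fin n × Fin N → ℝ)}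
    {V' : (Fin n × Fin N → ℝ) →ₗ[ℝ] (Fin n → Fin N → ℝ)}
    (hV' : ∀ w x, configInner (V' w) x = ∑ p, w p * V x p)
    (hV : ∀ x, ∑ p, V x p ^ 2 = configInner x x)
    {b τ : Fin n × Fin N → ℝ} {t : ℝ} (ht : 0 < t) (hτ : ∀ p, τ p ^ 2 = b p ^ 2 / (2 * t))
    (f : Fin n → Fin N → ℝ) {H : (Fin n → Fin N → ℝ) → ℝ}
    (hH : ∀ x, H x = 1 / 2 * ∑ p, b p * V x p ^ 2 + configInner f x) {M : ℝ}
    (hM : ∀ θ, H (configMean ρ θ) - tiltEntropy ρ θ ≤ M) {s : ℝ} (hs : 0 < s)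
    (g : Fin n × Fin N → ℝ) :
    ∫⁻ x, ENNReal.ofReal (Real.exp (H x - 1 / 2 * ∑ p, (τ p * V x p) ^ 2
        + ∑ p, τ p * V x p * g p)) ∂(Measure.pi fun _ : Fin n => ρ)
      ≤ ENNReal.ofReal (Real.exp (M + (t + s / 2) * (n * (N * R ^ 2)))) *
        ENNReal.ofReal (Real.exp (∑ p, τ p ^ 2 / (τ p ^ 2 + s) / 2 * g p ^ 2)) := by
  set Ψ : (Fin n → Fin N → ℝ) → ℝ := fun x =>
    H x - 1 / 2 * ∑ p, (τ p * V x p) ^ 2 + ∑ p, τ p * V x p * g p with hΨdef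
  have hΨ : ∀ x, Ψ x = 1 / 2 * ∑ p, (b p - τ p ^ 2) * V x p ^ 2
      + configInner (f + V' (fun p => τ p * g p)) x := by
    intro x
    simp only [hΨdef, hH, configInner_add_left, hV', sub_mul, Finset.sum_sub_distrib, mul_pow]
    have : ∑ p, τ p * V x p * g p = ∑ p, τ p * g p * V x p :=
      Finset.sum_congr rfl fun p _ => by ring
    rw [this]; ring
  obtain ⟨θ, hθ, -⟩ := exists_quadratic_maximizer hb hV' hV _ _ hΨ
  set a := configMean ρ θ with ha
  have haR : ∀ i k, |a i k| ≤ R := fun i k => abs_tiltMean_le hb (θ i) k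
  set K : ℝ := n * (N * R ^ 2) with hK
  set Q : ℝ := ∑ p, τ p ^ 2 / (τ p ^ 2 + s) / 2 * g p ^ 2 with hQ
  have hval : Ψ a - tiltEntropy ρ θ ≤ M + s / 2 * K + Q := by
    have h1 := hM θ
    have h2 : ∑ p, τ p * V a p * g p - 1 / 2 * ∑ p, (τ p * V a p) ^ 2
        - s / 2 * ∑ p, V a p ^ 2 ≤ Q := by
      rw [Finset.mul_sum, Finset.mul_sum, ← Finset.sum_sub_distrib, ← Finset.sum_sub_distrib]
      refine Finset.sum_le_sum fun p _ => ?_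
      have h3 : 0 < τ p ^ 2 + s := by positivity
      -- completing the square in `V a p`
      have h4 : τ p ^ 2 / (τ p ^ 2 + s) / 2 * g p ^ 2 - (τ p * V a p * g p
          - 1 / 2 * (τ p * V a p) ^ 2 - s / 2 * V a p ^ 2)
          = ((τ p ^ 2 + s) * V a p - τ p * g p) ^ 2 / (2 * (τ p ^ 2 + s)) := by
        field_simp; ring
      have h5 : 0 ≤ ((τ p ^ 2 + s) * V a p - τ p * g p) ^ 2 / (2 * (τ p ^ 2 + s)) := by
        positivity
      linarith
    have h6 : s / 2 * ∑ p, V a p ^ 2 ≤ s / 2 * K := by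
      rw [hV]
      exact mul_le_mul_of_nonneg_left (configInner_self_le haR) (by positivity)
    simp only [hΨdef]
    linarith
  have hbound : ∀ x : Fin n → Fin N → ℝ, (∀ i k, |x i k| ≤ R) → Ψ x ≤
      (M + (t + s / 2) * K + Q) + (configInner θ x - ∑ i, logMgf ρ (θ i)) := by
    intro x hx
    have h1 : 1 / 2 * ∑ p, (b p - τ p ^ 2) * V (x - a) p ^ 2 ≤ t * K := by
      have h2 : ∑ p, (b p - τ p ^ 2) * V (x - a) p ^ 2 ≤ t / 2 * configInner (x - a) (x - a) := by
        rw [← hV, Finset.mul_sum]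
        refine Finset.sum_le_sum fun p _ => mul_le_mul_of_nonneg_right ?_ (sq_nonneg _)
        have h3 : 0 ≤ (b p - t) ^ 2 / (2 * t) := by positivity
        have h4 : (b p - t) ^ 2 / (2 * t) = b p ^ 2 / (2 * t) - b p + t / 2 := by field_simp; ring
        rw [hτ]; linarith
      have h5 : configInner (x - a) (x - a) ≤ n * (N * (2 * R) ^ 2) :=
        configInner_self_le fun i k => by
          have := abs_sub (x i k) (a i k)
          simp only [Pi.sub_apply]
          linarith [hx i k, haR i k]
      have h6 := mul_le_mul_of_nonneg_left h5 (by positivity : 0 ≤ t / 4)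
      have h7 : t / 4 * (n * (N * (2 * R) ^ 2)) = t * K := by rw [hK]; ring
      linarith
    rw [hθ x, configInner_sub_right]
    rw [tiltEntropy_eq] at hval
    linarith
  have hint : Integrable (fun x : Fin n → Fin N → ℝ =>
      Real.exp (configInner θ x)) (Measure.pi fun _ : Fin n => ρ) := by
    simp_rw [configInner, Real.exp_sum]
    exact Integrable.fintype_prod (f := fun i z => Real.exp (θ i ⬝ᵥ z))
      fun i => integrable_exp_dotProduct hb (θ i)
  calc ∫⁻ x, ENNReal.ofReal (Real.exp (Ψ x)) ∂(Measure.pi fun _ : Fin n => ρ)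
      ≤ ∫⁻ x, ENNReal.ofReal (Real.exp (M + (t + s / 2) * K + Q - ∑ i, logMgf ρ (θ i))) *
          ENNReal.ofReal (Real.exp (configInner θ x)) ∂(Measure.pi fun _ : Fin n => ρ) := by
        refine lintegral_mono_ae ((ae_pi_bound fun _ => hb).mono fun x hx => ?_)
        rw [← ENNReal.ofReal_mul (Real.exp_pos _).le, ← Real.exp_add]
        refine ENNReal.ofReal_le_ofReal (Real.exp_le_exp.2 ?_)
        have := hbound x hx
        linarith
    _ = _ := by
        rw [lintegral_const_mul' _ _ ENNReal.ofReal_ne_top,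
          ← ofReal_integral_eq_lintegral_ofReal hint (ae_of_all _ fun _ => (Real.exp_pos _).le),
          integral_exp_configInner hb, ← ENNReal.ofReal_mul (Real.exp_pos _).le,
          ← ENNReal.ofReal_mul (Real.exp_pos _).le, ← Real.exp_add, ← Real.exp_add]
        congr 2
        ring

/-- The mean-field upper bound, by averaging over the Hubbard–Stratonovich field. -/
lemma lintegral_exp_le [IsProbabilityMeasure ρ] (hb : ∀ᵐ z ∂ρ, ∀ k, |z k| ≤ R)
    {V : (Fin n → Fin N → ℝ) →ₗ[ℝ] (Fin n × Fin N → ℝ)}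
    {V' : (Fin n × Fin N → ℝ) →ₗ[ℝ] (Fin n → Fin N → ℝ)}
    (hV' : ∀ w x, configInner (V' w) x = ∑ p, w p * V x p)
    (hV : ∀ x, ∑ p, V x p ^ 2 = configInner x x) (b : Fin n × Fin N → ℝ)
    (f : Fin n → Fin N → ℝ) {H : (Fin n → Fin N → ℝ) → ℝ}
    (hH : ∀ x, H x = 1 / 2 * ∑ p, b p * V x p ^ 2 + configInner f x) {M : ℝ}
    (hM : ∀ θ, H (configMean ρ θ) - tiltEntropy ρ θ ≤ M) {t s : ℝ} (ht : 0 < t) (hs : 0 < s) :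
    ∫⁻ x, ENNReal.ofReal (Real.exp (H x)) ∂(Measure.pi fun _ : Fin n => ρ)
      ≤ ENNReal.ofReal (Real.exp (M + (t + s / 2) * (n * (N * R ^ 2))
          + 1 / (4 * s * t) * ∑ p, b p ^ 2)) := by
  have hVc : Continuous V := V.continuous_of_finiteDimensional
  have hHc : Continuous H := by rw [funext hH]; fun_prop
  let τ : Fin n × Fin N → ℝ := fun p => b p / √(2 * t)
  have hτ : ∀ p, τ p ^ 2 = b p ^ 2 / (2 * t) := fun p => by
    rw [div_pow, Real.sq_sqrt (by positivity)]
  calc ∫⁻ x, ENNReal.ofReal (Real.exp (H x)) ∂(Measure.pi fun _ : Fin n => ρ)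
      = ∫⁻ x, ∫⁻ g, ENNReal.ofReal (Real.exp (H x - 1 / 2 * ∑ p, (τ p * V x p) ^ 2
          + ∑ p, τ p * V x p * g p)) ∂(Measure.pi fun _ => gaussianReal 0 1)
          ∂(Measure.pi fun _ : Fin n => ρ) := by
        refine lintegral_congr fun x => ?_
        simp_rw [Real.exp_add _ (∑ p, τ p * V x p * _), ENNReal.ofReal_mul (Real.exp_pos _).le]
        rw [lintegral_const_mul' _ _ ENNReal.ofReal_ne_top, lintegral_exp_sum_mul_gaussian,
          ← ENNReal.ofReal_mul (Real.exp_pos _).le, ← Real.exp_add, sub_add_cancel]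
    _ = ∫⁻ g, ∫⁻ x, ENNReal.ofReal (Real.exp (H x - 1 / 2 * ∑ p, (τ p * V x p) ^ 2
          + ∑ p, τ p * V x p * g p)) ∂(Measure.pi fun _ : Fin n => ρ)
          ∂(Measure.pi fun _ => gaussianReal 0 1) := by
        refine lintegral_lintegral_swap (Measurable.aemeasurable ?_)
        refine (Real.continuous_exp.comp ?_).measurable.ennreal_ofReal
        fun_prop
    _ ≤ ∫⁻ g, ENNReal.ofReal (Real.exp (M + (t + s / 2) * (n * (N * R ^ 2)))) *
        ENNReal.ofReal (Real.exp (∑ p, τ p ^ 2 / (τ p ^ 2 + s) / 2 * g p ^ 2))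
          ∂(Measure.pi fun _ => gaussianReal 0 1) :=
        lintegral_mono fun g => lintegral_exp_field_le hb hV' hV ht hτ f hH hM hs g
    _ ≤ ENNReal.ofReal (Real.exp (M + (t + s / 2) * (n * (N * R ^ 2)))) *
        ENNReal.ofReal (Real.exp (1 / (2 * s) * ∑ p, τ p ^ 2)) := by
        rw [lintegral_const_mul' _ _ ENNReal.ofReal_ne_top]
        gcongr
        exact lintegral_exp_sum_sq_gaussian_le (fun p => τ p ^ 2) (fun p => sq_nonneg _) hs
    _ = _ := by
        rw [← ENNReal.ofReal_mul (Real.exp_pos _).le, ← Real.exp_add]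
        simp_rw [hτ]
        rw [← Finset.sum_div]
        congr 3
        field_simp
        ring

end UpperBound

/-! ### The lower bound -/

section LowerBound

variable {N n : ℕ} {ρ : Measure (Fin N → ℝ)} {R : ℝ}

lemma integrable_pi_of_continuous {ν : Fin n → Measure (Fin N → ℝ)}
    [∀ i, IsProbabilityMeasure (ν i)] (hb : ∀ i, ∀ᵐ z ∂(ν i), ∀ k, |z k| ≤ R)
    {F : (Fin n → Fin N → ℝ) → ℝ} (hF : Continuous F) : Integrable F (Measure.pi ν) := by
  obtain ⟨C, hC⟩ := (isCompact_Icc (a := fun (_ : Fin n) (_ : Fin N) => -R)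
    (b := fun _ _ => R)).exists_bound_of_continuousOn hF.continuousOn
  exact Integrable.of_bound hF.aestronglyMeasurable C ((ae_pi_bound hb).mono fun x hx =>
    hC x ⟨fun i k => (abs_le.1 (hx i k)).1, fun i k => (abs_le.1 (hx i k)).2⟩)

/-- Jensen's inequality for the exponential function. -/
lemma exp_integral_le_integral_exp {Ω : Type*} [MeasurableSpace Ω] {μ : Measure Ω}
    [IsProbabilityMeasure μ] {u : Ω → ℝ} (hu : Integrable u μ)
    (hexp : Integrable (fun ω => Real.exp (u ω)) μ) :
    Real.exp (∫ ω, u ω ∂μ) ≤ ∫ ω, Real.exp (u ω) ∂μ :=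
  convexOn_exp.map_integral_le Real.continuous_exp.continuousOn isClosed_univ
    (ae_of_all _ fun _ => Set.mem_univ _) hu hexp

@[fun_prop]
lemma continuous_vectorSpinHamiltonian (J : Matrix (Fin N) (Fin N) ℝ) (h : Fin N → ℝ)
    (A : Matrix (Fin n) (Fin n) ℝ) : Continuous (vectorSpinHamiltonian J h A) := by
  unfold vectorSpinHamiltonian Matrix.mulVec dotProduct
  fun_prop

lemma abs_dotProduct_mulVec_le (J : Matrix (Fin N) (Fin N) ℝ) {z w : Fin N → ℝ}
    (hz : ∀ k, |z k| ≤ R) (hw : ∀ k, |w k| ≤ R) :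
    |z ⬝ᵥ (J *ᵥ w)| ≤ (∑ k, ∑ l, |J k l|) * R * R := by
  rcases isEmpty_or_nonempty (Fin N) with hN | ⟨⟨k₀⟩⟩
  · simp [dotProduct]
  have hR : 0 ≤ R := (abs_nonneg _).trans (hz k₀)
  rw [dotProduct_comm]
  refine (abs_dotProduct_le _ hz).trans (mul_le_mul_of_nonneg_right ?_ hR)
  rw [Finset.sum_mul]
  exact Finset.sum_le_sum fun k _ => abs_dotProduct_le (J k) hw

lemma integral_dotProduct_mulVec_of_ne {ν : Fin n → Measure (Fin N → ℝ)}
    [∀ i, IsProbabilityMeasure (ν i)] (hb : ∀ i, ∀ᵐ z ∂(ν i), ∀ k, |z k| ≤ R)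
    (J : Matrix (Fin N) (Fin N) ℝ) {i j : Fin n} (hij : i ≠ j) :
    ∫ x, x i ⬝ᵥ (J *ᵥ x j) ∂(Measure.pi ν) = meanVector ν i ⬝ᵥ (J *ᵥ meanVector ν j) := by
  have hind : IndepFun (fun x : Fin n → Fin N → ℝ => x i) (fun x => x j) (Measure.pi ν) :=
    (iIndepFun_pi (μ := ν) (X := fun _ => id) fun _ => aemeasurable_id).indepFun hij
  have heval : ∀ (m : Fin n) (k : Fin N),
      ∫ x : Fin n → Fin N → ℝ, x m k ∂(Measure.pi ν) = meanVector ν m k := fun m k => by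
    rw [meanVector, mean_apply (hb m)]
    exact integral_comp_eval (μ := ν) (i := m) (f := fun z : Fin N → ℝ => z k)
      (continuous_apply k).aestronglyMeasurable
  have hkl : ∀ k l, ∫ x : Fin n → Fin N → ℝ, x i k * (J k l * x j l) ∂(Measure.pi ν)
      = meanVector ν i k * (J k l * meanVector ν j l) := fun k l => by
    have h1 := (hind.comp (measurable_pi_apply k) (measurable_pi_apply l)
      ).integral_fun_mul_eq_mul_integral
        (Continuous.aestronglyMeasurable (by unfold Function.comp; fun_prop))
        (Continuous.aestronglyMeasurable (by unfold Function.comp; fun_prop))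
    simp only [Function.comp_apply, heval] at h1
    calc _ = ∫ x : Fin n → Fin N → ℝ, J k l * (x i k * x j l) ∂(Measure.pi ν) := by
          congr 1 with x; ring
      _ = _ := by rw [integral_const_mul, h1]; ring
  unfold Matrix.mulVec dotProduct
  simp_rw [Finset.mul_sum]
  rw [integral_finsetSum _ fun k _ => integrable_pi_of_continuous hb (by fun_prop)]
  refine Finset.sum_congr rfl fun k _ => ?_
  rw [integral_finsetSum _ fun l _ => integrable_pi_of_continuous hb (by fun_prop)]
  exact Finset.sum_congr rfl fun l _ => hkl k l

/-- Under a product measure only the diagonal couplings distinguish the mean energy from the energy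
of the mean. -/
lemma vectorSpinHamiltonian_mean_le {ν : Fin n → Measure (Fin N → ℝ)}
    [∀ i, IsProbabilityMeasure (ν i)] (hb : ∀ i, ∀ᵐ z ∂(ν i), ∀ k, |z k| ≤ R)
    (J : Matrix (Fin N) (Fin N) ℝ) (h : Fin N → ℝ) (A : Matrix (Fin n) (Fin n) ℝ) :
    vectorSpinHamiltonian J h A (meanVector ν) - (∑ k, ∑ l, |J k l|) * R * R * ∑ i, |A i i|
      ≤ ∫ x, vectorSpinHamiltonian J h A x ∂(Measure.pi ν) := by
  set C := (∑ k, ∑ l, |J k l|) * R * R with hC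
  have hcont : ∀ i j, Continuous fun x : Fin n → Fin N → ℝ => x i ⬝ᵥ (J *ᵥ x j) := fun i j => by
    unfold Matrix.mulVec dotProduct; fun_prop
  have hcont' : ∀ i, Continuous fun x : Fin n → Fin N → ℝ => x i ⬝ᵥ h := fun i => by
    unfold dotProduct; fun_prop
  have hlin : ∀ i, ∫ x, x i ⬝ᵥ h ∂(Measure.pi ν) = meanVector ν i ⬝ᵥ h := fun i => by
    rw [integral_comp_eval (μ := ν) (i := i) (f := fun z : Fin N → ℝ => z ⬝ᵥ h)
      (Continuous.aestronglyMeasurable (by unfold dotProduct; fun_prop))]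
    simp_rw [dotProduct_comm _ h]
    exact integral_dotProduct (hb i) h
  have hE : ∫ x, vectorSpinHamiltonian J h A x ∂(Measure.pi ν)
      = 1 / 2 * ∑ i, ∑ j, A i j * ∫ x, x i ⬝ᵥ (J *ᵥ x j) ∂(Measure.pi ν)
        + ∑ i, meanVector ν i ⬝ᵥ h := by
    unfold vectorSpinHamiltonian
    rw [integral_add (integrable_pi_of_continuous hb (by fun_prop))
      (integrable_pi_of_continuous hb (by fun_prop)), integral_const_mul,
      integral_finsetSum _ fun i _ => integrable_pi_of_continuous hb (by fun_prop),
      integral_finsetSum _ fun i _ => integrable_pi_of_continuous hb (by fun_prop)]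
    simp_rw [hlin]
    congr 2
    refine Finset.sum_congr rfl fun i _ => ?_
    rw [integral_finsetSum _ fun j _ => integrable_pi_of_continuous hb (by fun_prop)]
    simp_rw [integral_const_mul]
  have hterm : ∀ i j, A i j * (meanVector ν i ⬝ᵥ (J *ᵥ meanVector ν j))
      - (if i = j then 2 * C * |A i j| else 0)
      ≤ A i j * ∫ x, x i ⬝ᵥ (J *ᵥ x j) ∂(Measure.pi ν) := by
    intro i j
    split_ifs with hij
    · subst hij
      have h1 : |meanVector ν i ⬝ᵥ (J *ᵥ meanVector ν i)| ≤ C :=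
        abs_dotProduct_mulVec_le J (abs_mean_le (hb i)) (abs_mean_le (hb i))
      have h2 : |∫ x, x i ⬝ᵥ (J *ᵥ x i) ∂(Measure.pi ν)| ≤ C := by
        have := norm_integral_le_of_norm_le_const (μ := Measure.pi ν)
          (f := fun x : Fin n → Fin N → ℝ => x i ⬝ᵥ (J *ᵥ x i)) (C := C)
          ((ae_pi_bound hb).mono fun x hx => abs_dotProduct_mulVec_le J (hx i) (hx i))
        simpa using this
      have h3 : |meanVector ν i ⬝ᵥ (J *ᵥ meanVector ν i) -
          ∫ x, x i ⬝ᵥ (J *ᵥ x i) ∂(Measure.pi ν)| ≤ 2 * C := by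
        refine (abs_sub _ _).trans ?_
        linarith
      have h4 := le_abs_self (A i i * (meanVector ν i ⬝ᵥ (J *ᵥ meanVector ν i) -
          ∫ x, x i ⬝ᵥ (J *ᵥ x i) ∂(Measure.pi ν)))
      rw [abs_mul] at h4
      have h5 := mul_le_mul_of_nonneg_left h3 (abs_nonneg (A i i))
      linarith
    · rw [integral_dotProduct_mulVec_of_ne hb J hij, sub_zero]
  have hsum := Finset.sum_le_sum fun i (_ : i ∈ Finset.univ) =>
    Finset.sum_le_sum fun j (_ : j ∈ Finset.univ) => hterm i j
  simp only [Finset.sum_sub_distrib, Finset.sum_ite_eq, Finset.mem_univ, if_true] at hsum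
  rw [← Finset.mul_sum] at hsum
  rw [hE, vectorSpinHamiltonian]
  linarith

/-- The mean-field lower bound, from Gibbs' variational principle at a product of tilts. -/
lemma le_log_integral_exp [IsProbabilityMeasure ρ] (hb : ∀ᵐ z ∂ρ, ∀ k, |z k| ≤ R)
    (J : Matrix (Fin N) (Fin N) ℝ) (h : Fin N → ℝ) (A : Matrix (Fin n) (Fin n) ℝ)
    (θ : Fin n → Fin N → ℝ) :
    vectorSpinHamiltonian J h A (configMean ρ θ) - tiltEntropy ρ θ
        - (∑ k, ∑ l, |J k l|) * R * R * ∑ i, |A i i|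
      ≤ Real.log (∫ x, Real.exp (vectorSpinHamiltonian J h A x)
          ∂(Measure.pi fun _ : Fin n => ρ)) := by
  have hprob := fun i => isProbabilityMeasure_spinTilt hb (θ i)
  have hbt : ∀ i, ∀ᵐ z ∂(spinTilt ρ (θ i)), ∀ k, |z k| ≤ R := fun i =>
    spinTilt_ae_bound hb (θ i)
  have hH := continuous_vectorSpinHamiltonian J h A
  set H := vectorSpinHamiltonian J h A with hHdef
  have h1 := vectorSpinHamiltonian_mean_le hbt J h A
  have hθ : ∫ x, configInner θ x ∂(Measure.pi fun i => spinTilt ρ (θ i))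
      = configInner θ (configMean ρ θ) := by
    unfold configInner
    rw [integral_finsetSum _ fun i _ => integrable_pi_of_continuous hbt
      (by unfold dotProduct; fun_prop)]
    refine Finset.sum_congr rfl fun i _ => ?_
    rw [integral_comp_eval (μ := fun i => spinTilt ρ (θ i)) (i := i)
      (f := fun z : Fin N → ℝ => θ i ⬝ᵥ z) (continuous_dotProduct_left _).aestronglyMeasurable,
      integral_dotProduct (hbt i)]
    rfl
  have h2 := exp_integral_le_integral_exp
    (integrable_pi_of_continuous hbt (F := fun x => H x - configInner θ x) (by fun_prop))
    (integrable_pi_of_continuous hbt (by fun_prop))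
  rw [integral_sub (integrable_pi_of_continuous hbt (by fun_prop))
    (integrable_pi_of_continuous hbt (by fun_prop)), hθ, pi_spinTilt hb, integral_exp_tilted,
    ← pi_spinTilt hb, integral_exp_configInner hb, le_div_iff₀ (Real.exp_pos _),
    ← Real.exp_add] at h2
  have h3 : ∀ x, (configInner θ + fun x => H x - configInner θ x) x = H x := fun x => by simp
  simp_rw [h3] at h2
  have h4 := (Real.le_log_iff_exp_le ((Real.exp_pos _).trans_le h2)).2 h2
  rw [tiltEntropy_eq]
  have h5 : meanVector (fun i => spinTilt ρ (θ i)) = configMean ρ θ := rfl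
  rw [h5] at h1
  linarith

end LowerBound

/-! ### The maximum of the mean-field functional and the limit -/

section MeanField

variable {N n : ℕ} {ρ : Measure (Fin N → ℝ)} [IsProbabilityMeasure ρ] {R : ℝ}

lemma meanFieldValue_spinTilt_mem (hb : ∀ᵐ z ∂ρ, ∀ k, |z k| ≤ R) (J : Matrix (Fin N) (Fin N) ℝ)
    (h : Fin N → ℝ) (A : Matrix (Fin n) (Fin n) ℝ) (θ : Fin n → Fin N → ℝ) :
    ((vectorSpinHamiltonian J h A (configMean ρ θ) - tiltEntropy ρ θ : ℝ) : EReal)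
      ∈ meanFieldValues ρ J h A := by
  refine ⟨fun i => spinTilt ρ (θ i), fun i => isProbabilityMeasure_spinTilt hb (θ i), ?_, ?_⟩
  · rw [pi_spinTilt hb]
    exact tilted_absolutelyContinuous _ _
  · have hfin : ∀ i ∈ Finset.univ, InformationTheory.klDiv (spinTilt ρ (θ i)) ρ ≠ ⊤ :=
      fun i _ => (klDiv_spinTilt hb (θ i)).1
    rw [tiltEntropy_eq_sum_klDiv hb, ← ENNReal.toReal_sum hfin, EReal.coe_sub,
      EReal.coe_ennreal_toReal (ENNReal.sum_ne_top.2 hfin)]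
    rfl

/-- The mean-field functional attains its maximum, at a product of tilts, and its maximum
approximates the logarithm of the partition function, with an error controlled by `tr A²`. -/
lemma exists_isGreatest_meanFieldValues (hb : ∀ᵐ z ∂ρ, ∀ k, |z k| ≤ R)
    {J : Matrix (Fin N) (Fin N) ℝ} (hJ : J.IsSymm) (h : Fin N → ℝ)
    {A : Matrix (Fin n) (Fin n) ℝ} (hA : A.IsSymm) :
    ∃ M : ℝ, IsGreatest (meanFieldValues ρ J h A) (M : EReal) ∧
      M - (∑ k, ∑ l, |J k l|) * R * R * ∑ i, |A i i|
        ≤ Real.log (∫ x, Real.exp (vectorSpinHamiltonian J h A x)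
          ∂(Measure.pi fun _ : Fin n => ρ)) ∧
      ∀ t : ℝ, 0 < t → Real.log (∫ x, Real.exp (vectorSpinHamiltonian J h A x)
          ∂(Measure.pi fun _ : Fin n => ρ))
        ≤ M + (t + t / 2) * (n * (N * R ^ 2))
          + 1 / (4 * t * t) * ((A ^ 2).trace * (J ^ 2).trace) := by
  obtain ⟨b, V, V', hV', hV, hquad, htr⟩ := exists_diagonalisation hJ hA
  have hH : ∀ x, vectorSpinHamiltonian J h A x
      = 1 / 2 * ∑ p, b p * V x p ^ 2 + configInner (fun _ => h) x := fun x => by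
    rw [vectorSpinHamiltonian, hquad, configInner]
    simp_rw [dotProduct_comm h]
  obtain ⟨θ, -, hmax⟩ := exists_quadratic_maximizer hb hV' hV b _ hH
  set M := vectorSpinHamiltonian J h A (configMean ρ θ) - tiltEntropy ρ θ with hM
  have hgr : IsGreatest (meanFieldValues ρ J h A) (M : EReal) := by
    refine ⟨meanFieldValue_spinTilt_mem hb J h A θ, ?_⟩
    rintro v ⟨ν, hν, -, rfl⟩
    by_cases htop : ∑ i, InformationTheory.klDiv (ν i) ρ = ⊤
    · rw [htop, EReal.coe_ennreal_top, EReal.sub_top]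
      exact bot_le
    · have hfin : ∀ i ∈ Finset.univ, InformationTheory.klDiv (ν i) ρ ≠ ⊤ :=
        ENNReal.sum_ne_top.1 htop
      rw [← EReal.coe_ennreal_toReal htop, ENNReal.toReal_sum hfin, ← EReal.coe_sub,
        EReal.coe_le_coe_iff]
      exact hmax ν hν fun i => hfin i (Finset.mem_univ i)
  refine ⟨M, hgr, le_log_integral_exp hb J h A θ, fun t ht => ?_⟩
  have hle := lintegral_exp_le hb hV' hV b _ hH (M := M)
    (fun θ' => EReal.coe_le_coe_iff.1 (hgr.2 (meanFieldValue_spinTilt_mem hb J h A θ'))) ht ht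
  have hint : Integrable (fun x => Real.exp (vectorSpinHamiltonian J h A x))
      (Measure.pi fun _ : Fin n => ρ) :=
    integrable_pi_of_continuous (fun _ => hb) (by fun_prop)
  rw [← ofReal_integral_eq_lintegral_ofReal hint (ae_of_all _ fun _ => (Real.exp_pos _).le),
    ENNReal.ofReal_le_ofReal_iff (Real.exp_pos _).le, htr] at hle
  exact (Real.log_le_iff_le_exp (integral_exp_pos hint)).2 hle

lemma vectorSpinPartition_eq {W : Set (Fin N → ℝ)} (hW : ∀ᵐ z ∂ρ, z ∈ W)
    (J : Matrix (Fin N) (Fin N) ℝ) (h : Fin N → ℝ) (A : Matrix (Fin n) (Fin n) ℝ) :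
    vectorSpinPartition ρ W J h A = ∫ x, Real.exp (vectorSpinHamiltonian J h A x)
      ∂(Measure.pi fun _ : Fin n => ρ) := by
  rw [vectorSpinPartition, Measure.restrict_pi_pi, Measure.restrict_eq_self_of_ae_mem hW]

end MeanField

/-- A sequence is `o(n)` if, for each `t`, it is at most `K t n` plus an `o(n)` term. -/
lemma tendsto_div_of_forall_abs_le {u v : ℕ → ℝ} {K : ℝ} {c : ℝ → ℝ}
    (hv : v =o[atTop] fun n : ℕ => (n : ℝ))
    (hu : ∀ t : ℝ, 0 < t → ∀ n : ℕ, |u n| ≤ K * t * n + c t * v n) :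
    Tendsto (fun n : ℕ => 1 / (n : ℝ) * u n) atTop (𝓝 0) := by
  suffices h : u =o[atTop] fun n : ℕ => (n : ℝ) by
    simpa [div_eq_inv_mul] using h.tendsto_div_nhds_zero
  refine isLittleO_iff.2 fun ε hε => ?_
  set t := ε / (2 * (|K| + 1)) with htdef
  have ht : 0 < t := div_pos hε (by positivity)
  have hKt : K * t ≤ ε / 2 := by
    have h1 : K * t ≤ (|K| + 1) * t := by
      gcongr
      linarith [le_abs_self K]
    have h2 : (|K| + 1) * t = ε / 2 := by rw [htdef]; field_simp
    linarith
  filter_upwards [isLittleO_iff.1 (hv.const_mul_left (c t)) (half_pos hε)] with n hn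
  rw [Real.norm_eq_abs, Real.norm_natCast] at *
  have h1 := hu t ht n
  have h2 := mul_le_mul_of_nonneg_right hKt (Nat.cast_nonneg (α := ℝ) n)
  have h3 := (le_abs_self _).trans hn
  linarith

theorem mainTheorem4 (N : ℕ) (hN : 1 ≤ N)
    (W : Set (Fin N → ℝ)) (hW : IsCompact W)
    (ρ : Measure (Fin N → ℝ)) [IsProbabilityMeasure ρ] (hρ : ρ W = 1)
    (J : Matrix (Fin N) (Fin N) ℝ) (hJ : J.IsSymm) (h : Fin N → ℝ)
    (A : (n : ℕ) → Matrix (Fin n) (Fin n) ℝ) (hA : ∀ n, (A n).IsSymm)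
    (htr : (fun n : ℕ => (A n ^ 2).trace) =o[atTop] (fun n : ℕ => (n : ℝ)))
    (hsup : (fun n : ℕ => ⨆ x : Set.Icc (0 : Fin n → ℝ) 1, ∑ i, |∑ j, A n i j * x.1 j|)
      =O[atTop] (fun n : ℕ => (n : ℝ))) :
    ∃ M : ℕ → ℝ,
      (∀ n, IsGreatest (meanFieldValues ρ J h (A n)) (M n : EReal)) ∧
      Tendsto (fun n : ℕ => 1 / (n : ℝ) *
          (Real.log (vectorSpinPartition ρ W J h (A n)) - M n))
        atTop (𝓝 0) := by
  have hWae : ∀ᵐ z ∂ρ, z ∈ W := (mem_ae_iff_prob_eq_one hW.isClosed.measurableSet).2 hρ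
  obtain ⟨R, hR⟩ := hW.isBounded.exists_norm_le
  have hb : ∀ᵐ z ∂ρ, ∀ k, |z k| ≤ R := hWae.mono fun z hz k => (norm_le_pi_norm z k).trans (hR z hz)
  choose M hM hlow hup using fun n => exists_isGreatest_meanFieldValues hb hJ h (hA n)
  refine ⟨M, hM, ?_⟩
  set C := (∑ k, ∑ l, |J k l|) * R * R with hC
  have hC0 : 0 ≤ C := by
    rw [hC, mul_assoc]
    exact mul_nonneg (by positivity) (mul_self_nonneg R)
  have hJ0 : 0 ≤ (J ^ 2).trace := by rw [trace_sq_eq_sum_sq hJ]; positivity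
  refine tendsto_div_of_forall_abs_le (K := 3 / 2 * (N * R ^ 2) + C)
    (c := fun t => 1 / (4 * t * t) * (J ^ 2).trace + C * (1 / (4 * t))) htr fun t ht n => ?_
  have hA0 : 0 ≤ (A n ^ 2).trace := by rw [trace_sq_eq_sum_sq (hA n)]; positivity
  rw [vectorSpinPartition_eq hWae, abs_le]
  have h1 := hlow n
  have h2 := hup n t ht
  have h3 := mul_le_mul_of_nonneg_left (sum_abs_diag_le (hA n) ht) hC0
  have h4 : 0 ≤ 3 / 2 * (N * R ^ 2) * t * n := by positivity
  have h5 : 0 ≤ 1 / (4 * t * t) * (J ^ 2).trace * (A n ^ 2).trace := by positivity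
  have h6 : 0 ≤ C * t * n := by positivity
  have h7 : 0 ≤ C * (1 / (4 * t)) * (A n ^ 2).trace := by positivity
  constructor <;> linarith
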